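/- Let $\mathfrak{A}$ be a (not necessarily unital) $C^*$-algebra, let $H$ be a Hilbert $\mathfrak{A}$-module, and let $\mathcal{L}(H)$ be the $C^*$-algebra of adjointable operators on $H$, with unit $I$ and the operator norm. An element $T\in\mathcal{L}(H)$ is called M-P invertible if there is $X\in\mathcal{L}(H)$ with $$TXT=T,\qquad XTX=X,\qquad (TX)^*=TX,\qquad (XT)^*=XT;$$ such an $X$ is unique, is called the Moore-Penrose inverse of $T$, and is denoted by $T^\dagger$. **Theorem.** Let $A,B\in\mathcal{L}(H)$ be positive elements such that $A$ and $A+B$ are both M-P invertible. Then $(I-A^\dagger A)B(I-A^\dagger A)$ is M-P invertible, $\lambda A+B$ is M-P invertible for every real $\lambda>0$, and $$\lim_{\lambda\to+\infty}(\lambda A+B)^\dagger B=\big[(I-A^\dagger A)B(I-A^\dagger A)\big]^\dagger B$$ in the operator norm. -/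

import Mathlib

open Filter Topology

noncomputable section

section HilbertModule

variable (𝔄 : Type*) {H : Type*} [NonUnitalCStarAlgebra 𝔄] [PartialOrder 𝔄]
  [NormedAddCommGroup H] [NormedSpace ℂ H] [SMul 𝔄 H] [CStarModule 𝔄 H]

/-- `S` is an adjoint of `T` for the `𝔄`-valued inner product of `H`. -/
def IsAdjointOf (T S : H →L[ℂ] H) : Prop :=
  ∀ x y : H, inner 𝔄 (T x) y = inner 𝔄 x (S y)

variable {𝔄}

theorem CStarModule.ext_inner_left {x y : H} (h : ∀ z : H, inner 𝔄 z x = inner 𝔄 z y) :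
    x = y := by
  have h1 : inner 𝔄 (x - y) (x - y) = 0 := by
    rw [CStarModule.inner_sub_right, h, sub_self]
  exact sub_eq_zero.mp (CStarModule.inner_self.mp h1)

namespace IsAdjointOf

variable {T T' S S' : H →L[ℂ] H}

theorem unique (h : IsAdjointOf 𝔄 T S) (h' : IsAdjointOf 𝔄 T S') : S = S' := by
  ext y
  exact CStarModule.ext_inner_left (𝔄 := 𝔄) fun x => by rw [← h x y, ← h' x y]

theorem symm (h : IsAdjointOf 𝔄 T S) : IsAdjointOf 𝔄 S T := fun x y => by
  rw [← CStarModule.star_inner y (S x), ← h y x, CStarModule.star_inner]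

theorem add (h : IsAdjointOf 𝔄 T S) (h' : IsAdjointOf 𝔄 T' S') :
    IsAdjointOf 𝔄 (T + T') (S + S') := fun x y => by
  simp [h x y, h' x y]

theorem mul (h : IsAdjointOf 𝔄 T S) (h' : IsAdjointOf 𝔄 T' S') :
    IsAdjointOf 𝔄 (T * T') (S' * S) := fun x y => by
  simp [h _ _, h' _ _]

theorem smul (h : IsAdjointOf 𝔄 T S) (c : ℂ) : IsAdjointOf 𝔄 (c • T) (star c • S) :=
  fun x y => by
    simp only [smul_apply, CStarModule.inner_smul_left_complex,
      CStarModule.inner_smul_right_complex, h x y]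

theorem one : IsAdjointOf 𝔄 (1 : H →L[ℂ] H) 1 := fun _ _ => rfl

variable [StarOrderedRing 𝔄]

/-- The inequality behind the C⋆-identity. -/
theorem norm_mul_self_le (h : IsAdjointOf 𝔄 T S) : ‖T‖ * ‖T‖ ≤ ‖S * T‖ := by
  have key : ∀ x : H, ‖T x‖ ≤ √‖S * T‖ * ‖x‖ := fun x => by
    have h1 : ‖T x‖ ^ 2 ≤ ‖S * T‖ * ‖x‖ ^ 2 := by
      rw [CStarModule.norm_sq_eq 𝔄, h x (T x)]
      calc ‖inner 𝔄 x (S (T x))‖ ≤ ‖x‖ * ‖S (T x)‖ := CStarModule.norm_inner_le H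
        _ ≤ ‖x‖ * (‖S * T‖ * ‖x‖) := by
            gcongr
            exact (S * T).le_opNorm x
        _ = ‖S * T‖ * ‖x‖ ^ 2 := by ring
    calc ‖T x‖ = √(‖T x‖ ^ 2) := (Real.sqrt_sq (norm_nonneg _)).symm
      _ ≤ √(‖S * T‖ * ‖x‖ ^ 2) := Real.sqrt_le_sqrt h1
      _ = √‖S * T‖ * ‖x‖ := by
          rw [Real.sqrt_mul (norm_nonneg _), Real.sqrt_sq (norm_nonneg _)]
  have h2 := T.opNorm_le_bound (Real.sqrt_nonneg _) key
  calc ‖T‖ * ‖T‖ ≤ √‖S * T‖ * √‖S * T‖ := by gcongr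
    _ = ‖S * T‖ := Real.mul_self_sqrt (norm_nonneg _)

theorem norm_le (h : IsAdjointOf 𝔄 T S) : ‖T‖ ≤ ‖S‖ := by
  rcases (norm_nonneg T).eq_or_lt with h0 | h0
  · rw [← h0]
    exact norm_nonneg S
  · exact le_of_mul_le_mul_right (h.norm_mul_self_le.trans (norm_mul_le S T)) h0

end IsAdjointOf

variable (𝔄 H)

/-- The adjointable operators on `H`, as a subalgebra of the bounded operators. (An arbitrary map
that has an adjoint is automatically linear and bounded.) -/
def adjointableSubalgebra : Subalgebra ℂ (H →L[ℂ] H) where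
  carrier := {T | ∃ S : H →L[ℂ] H, IsAdjointOf 𝔄 T S}
  mul_mem' := fun ⟨_, h⟩ ⟨_, h'⟩ => ⟨_, h.mul h'⟩
  add_mem' := fun ⟨_, h⟩ ⟨_, h'⟩ => ⟨_, h.add h'⟩
  algebraMap_mem' := fun c => ⟨star c • 1, by
    rw [Algebra.algebraMap_eq_smul_one]
    exact IsAdjointOf.one.smul c⟩

/-- `𝓛(H)`: the adjointable operators on the Hilbert `𝔄`-module `H`, with composition as
multiplication and the operator norm. -/
def AdjointableOperator : Type _ := adjointableSubalgebra 𝔄 H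

namespace AdjointableOperator

instance : NormedRing (AdjointableOperator 𝔄 H) :=
  inferInstanceAs (NormedRing (adjointableSubalgebra 𝔄 H))

instance : NormedAlgebra ℂ (AdjointableOperator 𝔄 H) :=
  inferInstanceAs (NormedAlgebra ℂ (adjointableSubalgebra 𝔄 H))

variable {𝔄 H}

/-- The underlying bounded operator. -/
def toCLM (T : AdjointableOperator 𝔄 H) : H →L[ℂ] H := T.1

theorem exists_adjoint (T : AdjointableOperator 𝔄 H) :
    ∃ S : AdjointableOperator 𝔄 H, IsAdjointOf 𝔄 T.toCLM S.toCLM :=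
  let ⟨S, hS⟩ := T.2
  ⟨⟨S, ⟨T.1, hS.symm⟩⟩, hS⟩

/-- The involution is the adjoint: `⟪T x, y⟫ = ⟪x, (star T) y⟫`. -/
instance : Star (AdjointableOperator 𝔄 H) := ⟨fun T => T.exists_adjoint.choose⟩

theorem isAdjointOf_star (T : AdjointableOperator 𝔄 H) :
    IsAdjointOf 𝔄 T.toCLM (star T).toCLM := T.exists_adjoint.choose_spec

theorem star_eq_of_isAdjointOf {T S : AdjointableOperator 𝔄 H}
    (h : IsAdjointOf 𝔄 T.toCLM S.toCLM) : star T = S :=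
  Subtype.ext (T.isAdjointOf_star.unique h)

instance : StarRing (AdjointableOperator 𝔄 H) where
  star_involutive T := star_eq_of_isAdjointOf T.isAdjointOf_star.symm
  star_mul T S := star_eq_of_isAdjointOf (T.isAdjointOf_star.mul S.isAdjointOf_star)
  star_add T S := star_eq_of_isAdjointOf (T.isAdjointOf_star.add S.isAdjointOf_star)

instance : StarModule ℂ (AdjointableOperator 𝔄 H) where
  star_smul c T := star_eq_of_isAdjointOf (T.isAdjointOf_star.smul c)

variable [StarOrderedRing 𝔄]

instance : CStarRing (AdjointableOperator 𝔄 H) where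
  norm_mul_self_le T := T.isAdjointOf_star.norm_mul_self_le

variable [CompleteSpace H]

instance : CompleteSpace (AdjointableOperator 𝔄 H) := by
  have hclosed : IsClosed (adjointableSubalgebra 𝔄 H : Set (H →L[ℂ] H)) := by
    refine isClosed_of_closure_subset fun T hT => ?_
    obtain ⟨u, hu, hlim⟩ := mem_closure_iff_seq_limit.mp hT
    choose S hS using hu
    have hnorm : ∀ m n, ‖S m - S n‖ ≤ ‖u m - u n‖ := fun m n => by
      have h1 : IsAdjointOf 𝔄 (u m - u n) (S m - S n) := fun x y => by
        simp [hS m x y, hS n x y]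
      exact h1.symm.norm_le
    have hS_cauchy : CauchySeq S := by
      rw [Metric.cauchySeq_iff]
      intro ε hε
      obtain ⟨N, hN⟩ := Metric.cauchySeq_iff.mp hlim.cauchySeq ε hε
      refine ⟨N, fun m hm n hn => ?_⟩
      have h2 := hN m hm n hn
      rw [dist_eq_norm] at h2 ⊢
      exact (hnorm m n).trans_lt h2
    obtain ⟨S₀, hS₀⟩ := cauchySeq_tendsto_of_complete hS_cauchy
    refine ⟨S₀, fun x y => ?_⟩
    have hu_x : Tendsto (fun n => u n x) atTop (𝓝 (T x)) :=
      ((ContinuousLinearMap.apply ℂ H x).continuous.tendsto T).comp hlim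
    have hS_y : Tendsto (fun n => S n y) atTop (𝓝 (S₀ y)) :=
      ((ContinuousLinearMap.apply ℂ H y).continuous.tendsto S₀).comp hS₀
    have hl : Tendsto (fun n => inner 𝔄 (u n x) y) atTop (𝓝 (inner 𝔄 (T x) y)) :=
      (CStarModule.continuous_inner.tendsto (T x, y)).comp (hu_x.prodMk_nhds tendsto_const_nhds)
    have hr : Tendsto (fun n => inner 𝔄 x (S n y)) atTop (𝓝 (inner 𝔄 x (S₀ y))) :=
      (CStarModule.continuous_inner.tendsto (x, S₀ y)).comp
        (tendsto_const_nhds.prodMk_nhds hS_y)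
    exact tendsto_nhds_unique hl (hr.congr fun n => (hS n x y).symm)
  exact hclosed.completeSpace_coe

/-- `𝓛(H)` is a unital C⋆-algebra. -/
instance : CStarAlgebra (AdjointableOperator 𝔄 H) where

/-- The order of the C⋆-algebra `𝓛(H)`: `0 ≤ T` means that `T` is self-adjoint with spectrum in
`[0, ∞)`. -/
instance : PartialOrder (AdjointableOperator 𝔄 H) := CStarAlgebra.spectralOrder _

instance : StarOrderedRing (AdjointableOperator 𝔄 H) := CStarAlgebra.spectralOrderedRing _

end AdjointableOperator

end HilbertModule

section MoorePenrose

variable {R : Type*} [Semigroup R]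

/-- `x` is a Moore-Penrose inverse of `a`. -/
structure IsMoorePenroseInverse [Star R] (a x : R) : Prop where
  mul_mul_self : a * x * a = a
  self_mul_mul : x * a * x = x
  star_mul_right : star (a * x) = a * x
  star_mul_left : star (x * a) = x * a

/-- There is at most one Moore-Penrose inverse. -/
theorem IsMoorePenroseInverse.unique [StarMul R] {a x y : R}
    (hx : IsMoorePenroseInverse a x) (hy : IsMoorePenroseInverse a y) : x = y := by
  have h1 : a * x = a * y := by
    calc a * x = star (a * x) := hx.star_mul_right.symm
      _ = star ((a * y) * (a * x)) := by rw [← mul_assoc, hy.mul_mul_self]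
      _ = (a * x) * (a * y) := by rw [star_mul, hx.star_mul_right, hy.star_mul_right]
      _ = a * y := by rw [← mul_assoc, hx.mul_mul_self]
  have h2 : x * a = y * a := by
    calc x * a = star (x * a) := hx.star_mul_left.symm
      _ = star ((x * a) * (y * a)) := by rw [mul_assoc, ← mul_assoc a, hy.mul_mul_self]
      _ = (y * a) * (x * a) := by rw [star_mul, hx.star_mul_left, hy.star_mul_left]
      _ = y * a := by rw [mul_assoc, ← mul_assoc a, hx.mul_mul_self]
  calc x = x * a * x := hx.self_mul_mul.symm
    _ = y * a * y := by rw [h2, mul_assoc, h1, mul_assoc]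
    _ = y := hy.self_mul_mul

/-- `a` is M-P invertible. -/
def IsMPInvertible [Star R] (a : R) : Prop := ∃ x : R, IsMoorePenroseInverse a x

open Classical in
/-- The Moore-Penrose inverse `a†` of an M-P invertible element (the value `a` is a dummy when `a`
is not M-P invertible). -/
def mpInverse [Star R] (a : R) : R := if h : IsMPInvertible a then h.choose else a

theorem mpInverse_spec [Star R] {a : R} (h : IsMPInvertible a) :
    IsMoorePenroseInverse a (mpInverse a) := by
  rw [mpInverse, dif_pos h]
  exact h.choose_spec

end MoorePenrose

end

/-!
Let `p = A†A` and `q = (A + B)†(A + B)`, the support projections of `A` and `A + B`. Since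
`0 ≤ A, B ≤ A + B`, both operators live in the corner of `q`, and `f = q - p` is a projection
orthogonal to `p`. The compression `(1 - p) B (1 - p)` equals `f B f = f (A + B) f`; it is
invertible in the corner of `f` because `A + B` dominates a positive multiple of `q`. Let `z` be its
inverse there.

With respect to `q = p + f`, the Schur complement of `f B f` in `l A + B` is `l A + S`, where
`S = B - B z B ≥ 0`. As `A` is invertible in the corner of `p`, so is `l A + S ≥ l A`, and its
inverse `d` satisfies `0 ≤ d ≤ l⁻¹ A†`. Block inversion gives
`(l A + B)† = z + (1 - z B) d (1 - B z)`, hence `(l A + B)† = z + O(l⁻¹)`.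
-/

/-- `x` is the inverse of `m` in the corner `p R p` of the idempotent `p`. It is the common form of
the Moore-Penrose inverses in the proof, all of which are of self-adjoint elements. -/
structure IsCornerInverse {R : Type*} [Semigroup R] (p m x : R) : Prop where
  mul_inv : m * x = p
  inv_mul : x * m = p
  mul_proj : m * p = m
  inv_proj : x * p = x

namespace IsCornerInverse

section Semigroup

variable {R : Type*} [Semigroup R] {p m x : R}

theorem symm (h : IsCornerInverse p m x) : IsCornerInverse p x m :=
  ⟨h.inv_mul, h.mul_inv, h.inv_proj, h.mul_proj⟩

theorem proj_mul (h : IsCornerInverse p m x) : p * m = m := by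
  rw [← h.mul_inv, mul_assoc, h.inv_mul, h.mul_proj]

theorem proj_inv (h : IsCornerInverse p m x) : p * x = x :=
  h.symm.proj_mul

theorem isIdempotentElem (h : IsCornerInverse p m x) : IsIdempotentElem p := by
  calc p * p = m * (x * p) := by rw [← mul_assoc, h.mul_inv]
    _ = p := by rw [h.inv_proj, h.mul_inv]

theorem inv_mul_mul_proj {c f z : R} (h : IsCornerInverse f (f * c * f) z) : z * c * f = f := by
  calc z * c * f = z * f * c * f := by rw [h.inv_proj]
    _ = f := by rw [mul_assoc z f c, mul_assoc, h.inv_mul]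

theorem proj_mul_mul_inv {c f z : R} (h : IsCornerInverse f (f * c * f) z) : f * c * z = f := by
  calc f * c * z = f * c * (f * z) := by rw [h.proj_inv]
    _ = f := by rw [← mul_assoc, h.mul_inv]

theorem inv_mul_mul_inv {c f z : R} (h : IsCornerInverse f (f * c * f) z) : z * c * z = z := by
  calc z * c * z = z * c * f * z := by rw [mul_assoc (z * c), h.proj_inv]
    _ = z := by rw [h.inv_mul_mul_proj, h.proj_inv]

theorem isMoorePenroseInverse [Star R] (h : IsCornerInverse p m x) (hp : IsSelfAdjoint p) :
    IsMoorePenroseInverse m x where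
  mul_mul_self := by rw [h.mul_inv, h.proj_mul]
  self_mul_mul := by rw [h.inv_mul, h.proj_inv]
  star_mul_right := by rw [h.mul_inv, hp.star_eq]
  star_mul_left := by rw [h.inv_mul, hp.star_eq]

end Semigroup

theorem smul {𝕜 R : Type*} [DivisionRing 𝕜] [Ring R] [Module 𝕜 R] [IsScalarTower 𝕜 R R]
    [SMulCommClass 𝕜 R R] {p m x : R} (h : IsCornerInverse p m x) {r : 𝕜} (hr : r ≠ 0) :
    IsCornerInverse p (r • m) (r⁻¹ • x) where
  mul_inv := by rw [smul_mul_smul_comm, mul_inv_cancel₀ hr, one_smul, h.mul_inv]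
  inv_mul := by rw [smul_mul_smul_comm, inv_mul_cancel₀ hr, one_smul, h.inv_mul]
  mul_proj := by rw [smul_mul_assoc, h.mul_proj]
  inv_proj := by rw [smul_mul_assoc, h.inv_proj]

section Ring

variable {R : Type*} [Ring R]

theorem mul_add_one_sub_eq_one {p m x : R} (h : IsCornerInverse p m x) :
    (m + (1 - p)) * (x + (1 - p)) = 1 := by
  simp only [mul_add, add_mul, mul_sub, sub_mul, mul_one, one_mul, h.mul_inv, h.mul_proj,
    h.proj_inv, h.isIdempotentElem.eq]
  abel

/-- The Banachiewicz block inversion formula, where `c - c * z * c` is the Schur complement of the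
`f`-block of `c` with respect to the decomposition `p + f`. -/
theorem of_schurComplement {c p f z d : R} (hz : IsCornerInverse f (f * c * f) z)
    (hd : IsCornerInverse p (c - c * z * c) d) (hpf : p * f = 0) (hfp : f * p = 0)
    (hc_left : (p + f) * c = c) (hc_right : c * (p + f) = c) :
    IsCornerInverse (p + f) c (z + (1 - z * c) * d * (1 - c * z)) where
  mul_inv := by
    have hcz : p * c * z + f = c * z := by
      calc p * c * z + f = (p + f) * c * z := by rw [add_mul, add_mul, hz.proj_mul_mul_inv]
        _ = c * z := by rw [hc_left]
    calc c * (z + (1 - z * c) * d * (1 - c * z))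
        = c * z + (c - c * z * c) * d * (1 - c * z) := by noncomm_ring
      _ = c * z + (p - p * c * z) := by rw [hd.mul_inv, mul_sub, mul_one, mul_assoc p c z]
      _ = p + f := by rw [← sub_eq_iff_eq_add'.2 hcz.symm]; abel
  inv_mul := by
    have hzc : z * c * p + f = z * c := by
      calc z * c * p + f = z * (c * (p + f)) := by rw [← mul_assoc, mul_add, hz.inv_mul_mul_proj]
        _ = z * c := by rw [hc_right]
    calc (z + (1 - z * c) * d * (1 - c * z)) * c
        = z * c + (1 - z * c) * (d * (c - c * z * c)) := by noncomm_ring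
      _ = z * c + (p - z * c * p) := by rw [hd.inv_mul, sub_mul, one_mul]
      _ = p + f := by rw [← sub_eq_iff_eq_add'.2 hzc.symm]; abel
  mul_proj := hc_right
  inv_proj := by
    have hz_proj : z * (p + f) = z := by
      rw [mul_add, hz.inv_proj, ← hz.inv_proj, mul_assoc, hfp, mul_zero, zero_add]
    have hd_proj : d * (p + f) = d := by
      rw [mul_add, hd.inv_proj, ← hd.inv_proj, mul_assoc, hpf, mul_zero, add_zero]
    calc (z + (1 - z * c) * d * (1 - c * z)) * (p + f)
        = z * (p + f) + (1 - z * c) * (d * (p + f) - d * c * (z * (p + f))) := by noncomm_ring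
      _ = z + (1 - z * c) * d * (1 - c * z) := by rw [hz_proj, hd_proj]; noncomm_ring

end Ring

end IsCornerInverse

namespace IsMoorePenroseInverse

variable {R : Type*} [Semigroup R] [StarMul R] {a x : R}

theorem mpInverse_eq (h : IsMoorePenroseInverse a x) : mpInverse a = x :=
  (mpInverse_spec ⟨x, h⟩).unique h

protected theorem star (h : IsMoorePenroseInverse a x) :
    IsMoorePenroseInverse (star a) (star x) where
  mul_mul_self := by rw [mul_assoc, ← star_mul, ← star_mul, h.mul_mul_self]
  self_mul_mul := by rw [mul_assoc, ← star_mul, ← star_mul, h.self_mul_mul]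
  star_mul_right := by rw [← star_mul, h.star_mul_left, h.star_mul_left]
  star_mul_left := by rw [← star_mul, h.star_mul_right, h.star_mul_right]

theorem isSelfAdjoint (h : IsMoorePenroseInverse a x) (ha : IsSelfAdjoint a) : IsSelfAdjoint x :=
  IsMoorePenroseInverse.unique (ha.star_eq ▸ h.star) h

theorem isStarProjection_mul (h : IsMoorePenroseInverse a x) : IsStarProjection (x * a) where
  isIdempotentElem := by rw [IsIdempotentElem, ← mul_assoc, h.self_mul_mul]
  isSelfAdjoint := h.star_mul_left

theorem isCornerInverse (h : IsMoorePenroseInverse a x) (ha : IsSelfAdjoint a) :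
    IsCornerInverse (x * a) a x := by
  have hcomm : a * x = x * a := by
    rw [← h.star_mul_right, star_mul, ha.star_eq, (h.isSelfAdjoint ha).star_eq]
  exact ⟨hcomm, rfl, by rw [← mul_assoc, h.mul_mul_self],
    by rw [← hcomm, ← mul_assoc, h.self_mul_mul]⟩

end IsMoorePenroseInverse

section StarOrderedRing

variable {R : Type*} [Ring R] [StarRing R] [PartialOrder R] [StarOrderedRing R]

theorem IsCornerInverse.nonneg {p m x : R} (h : IsCornerInverse p m x) (hp : IsSelfAdjoint p)
    (hm : 0 ≤ m) : 0 ≤ x := by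
  have hx : IsSelfAdjoint x := (h.isMoorePenroseInverse hp).isSelfAdjoint (.of_nonneg hm)
  simpa only [h.inv_mul, h.proj_inv] using hx.conjugate_nonneg hm

theorem sub_mul_mul_nonneg {b z : R} (hb : 0 ≤ b) (hz : IsSelfAdjoint z) (hzbz : z * b * z = z) :
    0 ≤ b - b * z * b := by
  have h := star_left_conjugate_nonneg hb (1 - z * b)
  rw [star_sub, star_one, star_mul, hz.star_eq, (IsSelfAdjoint.of_nonneg hb).star_eq] at h
  calc 0 ≤ (1 - b * z) * b * (1 - z * b) := h
    _ = b - b * z * b - b * z * b + b * (z * b * z) * b := by noncomm_ring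
    _ = b - b * z * b := by rw [hzbz]; abel

end StarOrderedRing

section CStarAlgebra

theorem mul_eq_zero_of_nonneg_of_le {L : Type*} [NonUnitalCStarAlgebra L] [PartialOrder L]
    [StarOrderedRing L] {a c r : L} (ha : 0 ≤ a) (hac : a ≤ c) (hr : c * r = 0) : a * r = 0 := by
  have hconj : star r * a * r = 0 := by
    refine le_antisymm ?_ (star_left_conjugate_nonneg ha r)
    grw [star_left_conjugate_le_conjugate hac r, mul_assoc, hr, mul_zero]
  have hsqrt : CFC.sqrt a * r = 0 := by
    rw [← norm_eq_zero, ← sq_eq_zero_iff, ← CFC.norm_star_mul_mul_self_of_nonneg, hconj, norm_zero]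
  rw [← CFC.sqrt_mul_sqrt_self a ha, mul_assoc, hsqrt, mul_zero]

variable {L : Type*} [CStarAlgebra L] [PartialOrder L] [StarOrderedRing L]

theorem IsMoorePenroseInverse.mul_support_of_le {a c y : L} (hy : IsMoorePenroseInverse c y)
    (ha : 0 ≤ a) (hac : a ≤ c) : a * (y * c) = a := by
  have hc : c * (1 - y * c) = 0 := by
    rw [mul_sub, mul_one, ← mul_assoc, hy.mul_mul_self, sub_self]
  simpa only [mul_sub, mul_one, sub_eq_zero, eq_comm] using mul_eq_zero_of_nonneg_of_le ha hac hc

namespace IsCornerInverse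

variable {p q f c m x y : L}

theorem exists_le_of_le (h : IsCornerInverse p c x) (hp : IsStarProjection p) (hc : 0 ≤ c)
    (hcm : c ≤ m) (hmp : m * p = m) : ∃ d, IsCornerInverse p m d ∧ d ≤ x := by
  have hpm : p * m = m := by
    simpa only [star_mul, hp.isSelfAdjoint.star_eq,
      (IsSelfAdjoint.of_nonneg (hc.trans hcm)).star_eq] using congr(star $hmp)
  let v : Lˣ := ⟨c + (1 - p), x + (1 - p), h.mul_add_one_sub_eq_one, h.symm.mul_add_one_sub_eq_one⟩
  have hv : 0 ≤ (v : L) := add_nonneg hc hp.one_sub.nonneg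
  have hvm : (v : L) ≤ m + (1 - p) := add_le_add_left hcm _
  obtain ⟨u, hu⟩ := CStarAlgebra.isUnit_of_le (v : L) hvm (v.isUnit.isStrictlyPositive hv)
  have hup : u * p = m := by
    rw [hu, add_mul, hp.one_sub_mul_self, hmp, add_zero]
  have hpu : p * u = m := by
    rw [hu, mul_add, hp.mul_one_sub_self, hpm, add_zero]
  have hcomm : Commute (↑u⁻¹ : L) p := Commute.units_inv_left (hup.trans hpu.symm)
  have hpup : p * ↑u⁻¹ * p = ↑u⁻¹ * p := by
    rw [mul_assoc, hcomm.eq, ← mul_assoc, hp.isIdempotentElem.eq]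
  refine ⟨p * ↑u⁻¹ * p, ⟨?_, ?_, ?_, ?_⟩, ?_⟩
  · rw [hpup, ← hpu, mul_assoc, u.mul_inv_cancel_left, hp.isIdempotentElem.eq]
  · rw [mul_assoc, hpm, ← hup, mul_assoc, u.inv_mul_cancel_left, hp.isIdempotentElem.eq]
  · exact hmp
  · rw [mul_assoc, hp.isIdempotentElem.eq]
  · calc p * ↑u⁻¹ * p ≤ p * ↑v⁻¹ * p :=
          hp.isSelfAdjoint.conjugate_le_conjugate (CStarAlgebra.inv_le_inv hv (hu ▸ hvm))
      _ = p * (x + (1 - p)) * p := rfl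
      _ = x := by
          rw [mul_add, hp.mul_one_sub_self, add_zero, h.proj_inv, h.inv_proj]

theorem proj_le_norm_smul (h : IsCornerInverse q c y) (hq : IsSelfAdjoint q) (hc : 0 ≤ c) :
    q ≤ ‖y‖ • c := by
  have hy := h.nonneg hq hc
  have hr : IsSelfAdjoint (CFC.sqrt y) := .of_nonneg (CFC.sqrt_nonneg y)
  have hstar : star (CFC.sqrt y * c) = c * CFC.sqrt y := by
    rw [star_mul, hr.star_eq, (IsSelfAdjoint.of_nonneg hc).star_eq]
  have hyy : y * y = CFC.sqrt y * y * CFC.sqrt y := by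
    have hsqrt := CFC.sqrt_mul_sqrt_self y hy
    calc y * y = CFC.sqrt y * (CFC.sqrt y * CFC.sqrt y) * CFC.sqrt y := by
          nth_rw 1 2 [← hsqrt]
          simp only [mul_assoc]
      _ = CFC.sqrt y * y * CFC.sqrt y := by rw [hsqrt]
  calc q = (c * y) * (y * c) := by rw [h.mul_inv, h.inv_mul, h.isIdempotentElem.eq]
    _ = star (CFC.sqrt y * c) * y * (CFC.sqrt y * c) := by
        rw [hstar, mul_assoc, ← mul_assoc y, hyy]
        simp only [mul_assoc]
    _ ≤ ‖y‖ • (star (CFC.sqrt y * c) * (CFC.sqrt y * c)) :=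
        CStarAlgebra.star_left_conjugate_le_norm_smul (.of_nonneg hy)
    _ = ‖y‖ • c := by
        rw [hstar, mul_assoc, ← mul_assoc (CFC.sqrt y), CFC.sqrt_mul_sqrt_self y hy, h.inv_mul,
          h.mul_proj]

theorem exists_compression (h : IsCornerInverse q c y) (hq : IsSelfAdjoint q) (hc : 0 ≤ c)
    (hf : IsStarProjection f) (hqf : q * f = f) : ∃ z, IsCornerInverse f (f * c * f) z := by
  let r : ℝ := ‖y‖ + 1
  have hr : 0 < r := by positivity
  have hqc : q ≤ r • c := by
    refine (h.proj_le_norm_smul hq hc).trans ?_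
    gcongr
    exact le_add_of_nonneg_right zero_le_one
  have hfc : r⁻¹ • f ≤ f * c * f := by
    rw [inv_smul_le_iff_of_pos hr]
    have := hf.isSelfAdjoint.conjugate_le_conjugate hqc
    rwa [mul_assoc, hqf, hf.isIdempotentElem.eq, mul_smul_comm, smul_mul_assoc] at this
  have hff : IsCornerInverse f f f := by
    constructor <;> exact hf.isIdempotentElem
  obtain ⟨z, hz, -⟩ := (hff.smul (inv_ne_zero hr.ne')).exists_le_of_le hf
    (smul_nonneg (inv_nonneg.2 hr.le) hf.nonneg) hfc (by rw [mul_assoc, hf.isIdempotentElem.eq])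
  exact ⟨z, hz⟩

end IsCornerInverse

theorem exists_isCornerInverse_add {a b p f x z : L} (ha : 0 ≤ a) (hb : 0 ≤ b)
    (hp : IsStarProjection p) (hf : IsStarProjection f) (hpf : p * f = 0)
    (hb_supp : b * (p + f) = b) (hx : IsCornerInverse p a x)
    (hz : IsCornerInverse f (f * b * f) z) :
    ∃ d, 0 ≤ d ∧ d ≤ x ∧
      IsCornerInverse (p + f) (a + b) (z + (1 - z * b) * d * (1 - b * z)) := by
  have hfp : f * p = 0 := by
    simpa [hp.isSelfAdjoint.star_eq, hf.isSelfAdjoint.star_eq] using congr(star $hpf)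
  have haf : a * f = 0 := by rw [← hx.mul_proj, mul_assoc, hpf, mul_zero]
  have hfa : f * a = 0 := by rw [← hx.proj_mul, ← mul_assoc, hfp, zero_mul]
  have hcz : (a + b) * z = b * z := by
    rw [add_mul, ← hz.proj_inv, ← mul_assoc a, haf, zero_mul, zero_add]
  have hzc : z * (a + b) = z * b := by
    rw [mul_add, ← hz.inv_proj, mul_assoc z f a, hfa, mul_zero, zero_add]
  have hschur : (a + b) - (a + b) * z * (a + b) = a + (b - b * z * b) := by
    rw [hcz, mul_assoc, hzc, mul_assoc, add_sub_assoc]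
  have hschur_nonneg : 0 ≤ b - b * z * b :=
    sub_mul_mul_nonneg hb (.of_nonneg <|
      hz.nonneg hf.isSelfAdjoint (hf.isSelfAdjoint.conjugate_nonneg hb)) hz.inv_mul_mul_inv
  have hschur_proj : (b - b * z * b) * p = b - b * z * b := by
    have hschur_f : (b - b * z * b) * f = 0 := by
      rw [sub_mul, mul_assoc, mul_assoc, ← mul_assoc z, hz.inv_mul_mul_proj, sub_self]
    calc (b - b * z * b) * p = (b - b * z * b) * (p + f) := by rw [mul_add, hschur_f, add_zero]
      _ = b - b * z * b := by rw [sub_mul, mul_assoc (b * z), hb_supp]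
  obtain ⟨d, hd, hdx⟩ := hx.exists_le_of_le hp ha (le_add_of_nonneg_right hschur_nonneg)
    (by rw [add_mul, hx.mul_proj, hschur_proj])
  refine ⟨d, hd.nonneg hp.isSelfAdjoint (add_nonneg ha hschur_nonneg), hdx, ?_⟩
  have hc_right : (a + b) * (p + f) = a + b := by
    rw [add_mul, mul_add a, hx.mul_proj, haf, add_zero, hb_supp]
  have hc_left : (p + f) * (a + b) = a + b := by
    simpa only [star_mul, (hp.add hf hpf).isSelfAdjoint.star_eq,
      (IsSelfAdjoint.of_nonneg (add_nonneg ha hb)).star_eq] using congr(star $hc_right)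
  rw [← hzc, ← hcz]
  refine .of_schurComplement ?_ (hschur ▸ hd) hpf hfp hc_left hc_right
  rwa [mul_add, hfa, zero_add]

theorem exists_isStarProjection_compression {a b x y : L} (ha : 0 ≤ a) (hb : 0 ≤ b)
    (hx : IsMoorePenroseInverse a x) (hy : IsMoorePenroseInverse (a + b) y) :
    ∃ f z : L, IsStarProjection f ∧ x * a * f = 0 ∧ b * (x * a + f) = b ∧
      (1 - x * a) * b * (1 - x * a) = f * b * f ∧ IsCornerInverse f (f * b * f) z := by
  have hab : IsSelfAdjoint (a + b) := .of_nonneg (add_nonneg ha hb)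
  have hp := hx.isStarProjection_mul
  have hq := hy.isStarProjection_mul
  have haq := hy.mul_support_of_le ha (le_add_of_nonneg_right hb)
  have hbq := hy.mul_support_of_le hb (le_add_of_nonneg_left ha)
  have hqc := hy.isCornerInverse hab
  have hpa := (hx.isCornerInverse (.of_nonneg ha)).mul_proj
  set p := x * a with hp_def
  set q := y * (a + b)
  have hpq : p * q = p := by rw [hp_def, mul_assoc, haq]
  have hf : IsStarProjection (q - p) := hp.sub_of_mul_eq_left hq hpq
  have hqf : q * (q - p) = q - p := by
    simpa only [star_mul, hf.isSelfAdjoint.star_eq, hq.isSelfAdjoint.star_eq] using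
      congr(star $(show (q - p) * q = q - p by rw [sub_mul, hpq, hq.isIdempotentElem.eq]))
  have haf : a * (q - p) = 0 := by rw [mul_sub, haq, hpa, sub_self]
  obtain ⟨z, hz⟩ := hqc.exists_compression hq.isSelfAdjoint (add_nonneg ha hb) hf hqf
  have hbf : b * (1 - p) = b * (q - p) := by rw [mul_sub, mul_sub, mul_one, hbq]
  have hfb : (1 - p) * b = (q - p) * b := by
    simpa only [star_mul, hp.one_sub.isSelfAdjoint.star_eq, hf.isSelfAdjoint.star_eq,
      (IsSelfAdjoint.of_nonneg hb).star_eq] using congr(star $hbf)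
  refine ⟨q - p, z, hf, ?_, ?_, ?_, ?_⟩
  · rw [mul_sub, hpq, hp.isIdempotentElem.eq, sub_self]
  · rw [add_sub_cancel, hbq]
  · rw [hfb, mul_assoc, hbf, ← mul_assoc]
  · rwa [mul_assoc, add_mul, haf, zero_add, ← mul_assoc] at hz

end CStarAlgebra

open Asymptotics in
theorem mainTheorem9_general {L : Type*} [CStarAlgebra L] [PartialOrder L] [StarOrderedRing L]
    {a b : L} (ha : 0 ≤ a) (hb : 0 ≤ b)
    (ha_mp : IsMPInvertible a) (hab_mp : IsMPInvertible (a + b)) :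
    IsMPInvertible ((1 - mpInverse a * a) * b * (1 - mpInverse a * a)) ∧
    (∀ l : ℝ, 0 < l → IsMPInvertible (l • a + b)) ∧
    (fun l : ℝ => mpInverse (l • a + b) -
      mpInverse ((1 - mpInverse a * a) * b * (1 - mpInverse a * a))) =O[atTop] fun l => l⁻¹ := by
  obtain ⟨x, hx⟩ := ha_mp
  obtain ⟨y, hy⟩ := hab_mp
  obtain ⟨f, z, hf, hpf, hb_supp, hcompr, hz⟩ :=
    exists_isStarProjection_compression ha hb hx hy
  have hp := hx.isStarProjection_mul
  have hz_mp := hz.isMoorePenroseInverse hf.isSelfAdjoint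
  have hblock (l : ℝ) (hl : 0 < l) : ∃ d, 0 ≤ d ∧ d ≤ l⁻¹ • x ∧
      IsMoorePenroseInverse (l • a + b) (z + (1 - z * b) * d * (1 - b * z)) := by
    obtain ⟨d, hd, hdx, hinv⟩ := exists_isCornerInverse_add (smul_nonneg hl.le ha) hb hp hf hpf
      hb_supp ((hx.isCornerInverse (.of_nonneg ha)).smul hl.ne') hz
    exact ⟨d, hd, hdx, hinv.isMoorePenroseInverse (hp.add hf hpf).isSelfAdjoint⟩
  rw [hx.mpInverse_eq, hcompr, hz_mp.mpInverse_eq]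
  refine ⟨⟨z, hz_mp⟩, fun l hl => ?_, ?_⟩
  · obtain ⟨d, -, -, hd⟩ := hblock l hl
    exact ⟨_, hd⟩
  · refine .of_bound (‖1 - z * b‖ * ‖x‖ * ‖1 - b * z‖) ?_
    filter_upwards [eventually_gt_atTop 0] with l hl
    obtain ⟨d, hd_nonneg, hdx, hd⟩ := hblock l hl
    have hd_norm : ‖d‖ ≤ ‖l⁻¹‖ * ‖x‖ := by
      simpa only [norm_smul] using CStarAlgebra.norm_le_norm_of_nonneg_of_le hd_nonneg hdx
    rw [hd.mpInverse_eq, add_sub_cancel_left]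
    calc ‖(1 - z * b) * d * (1 - b * z)‖ ≤ ‖1 - z * b‖ * ‖d‖ * ‖1 - b * z‖ := norm_mul₃_le
      _ ≤ ‖1 - z * b‖ * (‖l⁻¹‖ * ‖x‖) * ‖1 - b * z‖ := by gcongr
      _ = ‖1 - z * b‖ * ‖x‖ * ‖1 - b * z‖ * ‖l⁻¹‖ := by ring

theorem mainTheorem9 {𝔄 H : Type*} [NonUnitalCStarAlgebra 𝔄] [PartialOrder 𝔄] [StarOrderedRing 𝔄]
    [NormedAddCommGroup H] [NormedSpace ℂ H] [SMul 𝔄 H] [CStarModule 𝔄 H] [CompleteSpace H]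
    (A B : AdjointableOperator 𝔄 H) (hA : 0 ≤ A) (hB : 0 ≤ B)
    (hA_mp : IsMPInvertible A) (hAB_mp : IsMPInvertible (A + B)) :
    IsMPInvertible ((1 - mpInverse A * A) * B * (1 - mpInverse A * A)) ∧
    (∀ l : ℝ, 0 < l → IsMPInvertible (l • A + B)) ∧
    Tendsto (fun l : ℝ => mpInverse (l • A + B) * B) atTop
      (𝓝 (mpInverse ((1 - mpInverse A * A) * B * (1 - mpInverse A * A)) * B)) :=
  let ⟨hC, hl, hO⟩ := mainTheorem9_general hA hB hA_mp hAB_mp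
  ⟨hC, hl, (tendsto_sub_nhds_zero_iff.1 (hO.trans_tendsto tendsto_inv_atTop_zero)).mul_const B⟩
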